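/- Let $A,B$ be $n\times n$ complex Hermitian matrices. Write $n_+(A)$, $n_-(A)$ for the numbers of positive and negative eigenvalues of $A$ (with multiplicity), and likewise for $B$. For the pencil $A-zB$ put $A-\infty B:=B$ and let $r=\max_{z\in\mathbb C\cup\{\infty\}}\operatorname{rank}(A-zB)$; a point $\lambda\in\mathbb C\cup\{\infty\}$ is an eigenvalue of $(A,B)$ if $\operatorname{rank}(A-\lambda B)<r$ (the pencil may be singular, i.e. $r<n$). The algebraic multiplicity of a real eigenvalue $\lambda$ is the sum of the orders of vanishing at $t=\lambda$ of those real-analytic eigenvalue functions $\lambda_i(t)$ of $A-tB$ $(t\in\mathbb R)$ that are not identically zero; equivalently, it is the multiplicity of $\lambda$ as a zero of the polynomial in $t$ that is the lowest not identically vanishing coefficient, in powers of $x$, of $\det(xI-(A-tB))$. (If the pencil is regular, this is the multiplicity of $\lambda$ as a zero of $\det(A-tB)$.) Let $n_+(A,B)$, $n_-(A,B)$, $n_{\mathbb R}(A,B)$ be the numbers of positive, negative, and finite real eigenvalues of $(A,B)$, respectively, counted with algebraic multiplicity. Let $k\ge 0$ be an integer. Suppose that $B$ has exactly $n-k$ positive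 eigenvalues, $n_+(B)=n-k$, and that $n-k\ge |n_-(A)-n_+(A)|$. Then \[ \begin{aligned} n_+(A)-k&\le n_+(A,B)\le n_+(A)+k,\\ n_-(A)-k&\le n_-(A,B)\le n_-(A)+k,\\ n-2k&\le n_{\mathbb R}(A,B)\le n. \end{aligned} \] -/

import Mathlib

open scoped Matrix

noncomputable section

namespace HermitianPencil

variable {n : ℕ}

/-- `n₊(A)`: the number of positive eigenvalues of a Hermitian matrix, with multiplicity. -/
def nPos {A : Matrix (Fin n) (Fin n) ℂ} (hA : A.IsHermitian) : ℕ :=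
  (Finset.univ.filter fun i => 0 < hA.eigenvalues i).card

/-- `n₋(A)`: the number of negative eigenvalues of a Hermitian matrix, with multiplicity. -/
def nNeg {A : Matrix (Fin n) (Fin n) ℂ} (hA : A.IsHermitian) : ℕ :=
  (Finset.univ.filter fun i => hA.eigenvalues i < 0).card

/-- The value `A - z B` of the pencil at `z ∈ ℂ ∪ {∞}`, where `A - ∞ B := B`. -/
def pencilAt (A B : Matrix (Fin n) (Fin n) ℂ) : OnePoint ℂ → Matrix (Fin n) (Fin n) ℂ
  | none => B
  | some z => A - z • B

/-- The normal rank `r` of the pencil: the largest rank of `A - z B` over `z ∈ ℂ ∪ {∞}`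
(a supremum of natural numbers bounded by `n`). -/
def normalRank (A B : Matrix (Fin n) (Fin n) ℂ) : ℕ :=
  ⨆ z : OnePoint ℂ, (pencilAt A B z).rank

/-- `z ∈ ℂ ∪ {∞}` is an eigenvalue of the pencil (possibly singular) if the rank drops at `z`. -/
def IsEigenvalue (A B : Matrix (Fin n) (Fin n) ℂ) (z : OnePoint ℂ) : Prop :=
  (pencilAt A B z).rank < normalRank A B

/-- The pencil `A - t B` as a matrix of polynomials in the indeterminate `t`. -/
def polyPencil (A B : Matrix (Fin n) (Fin n) ℂ) : Matrix (Fin n) (Fin n) (Polynomial ℂ) :=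
  A.map Polynomial.C - (Polynomial.X : Polynomial ℂ) • B.map Polynomial.C

/-- The product, up to sign, of those eigenvalue functions of `t ↦ A - t B` that are not
identically zero. If `λ₁(t), …, λₙ(t)` are the eigenvalues of `A - t B`, then
`det (x I - (A - t B)) = ∏ i, (x - λᵢ(t))`, so this product is, up to sign, the lowest
coefficient, in powers of `x`, that is not the zero polynomial in `t`. For a regular pencil
it is `± det (A - t B)`. -/
def eigenfunctionProd (A B : Matrix (Fin n) (Fin n) ℂ) : Polynomial ℂ :=
  (polyPencil A B).charpoly.trailingCoeff

/-- The algebraic multiplicity of the real number `μ` for the Hermitian pencil `A - t B`: the sum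
of the multiplicities of `μ` as a zero of the eigenvalue functions of `t ↦ A - t B` that are not
identically zero, that is, the multiplicity of `μ` as a zero of their product. The agreement with
the sum over any analytic enumeration of the eigenvalues is `algMult_eq_sum_order` below. -/
def algMult (A B : Matrix (Fin n) (Fin n) ℂ) (μ : ℝ) : ℕ :=
  (eigenfunctionProd A B).rootMultiplicity (μ : ℂ)

open scoped Classical in
/-- The number of finite real eigenvalues of the pencil in `S ⊆ ℝ`, with algebraic multiplicity.
(The sum has finite support, since a polynomial has finitely many roots.) -/
def countIn (A B : Matrix (Fin n) (Fin n) ℂ) (S : Set ℝ) : ℕ :=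
  ∑ᶠ μ : ℝ, if μ ∈ S ∧ IsEigenvalue A B (((μ : ℝ) : ℂ) : OnePoint ℂ) then algMult A B μ else 0

/-- `n₊(A, B)`: the number of positive eigenvalues of the pencil. -/
def pencilPos (A B : Matrix (Fin n) (Fin n) ℂ) : ℕ := countIn A B (Set.Ioi 0)

/-- `n₋(A, B)`: the number of negative eigenvalues of the pencil. -/
def pencilNeg (A B : Matrix (Fin n) (Fin n) ℂ) : ℕ := countIn A B (Set.Iio 0)

/-- `n_R(A, B)`: the number of finite real eigenvalues of the pencil. -/
def pencilReal (A B : Matrix (Fin n) (Fin n) ℂ) : ℕ := countIn A B Set.univ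

theorem eval_coeff_charpoly (A B : Matrix (Fin n) (Fin n) ℂ) (z : ℂ) (j : ℕ) :
    ((polyPencil A B).charpoly.coeff j).eval z = (A - z • B).charpoly.coeff j := by
  have h : (polyPencil A B).map (Polynomial.evalRingHom z) = A - z • B := by
    ext i j
    simp [polyPencil]
    exact mul_comm _ _
  rw [← h, Matrix.charpoly_map, Polynomial.coeff_map, Polynomial.coe_evalRingHom]

open scoped Classical in
/-- Whenever the eigenvalues of `A - t B`, `t ∈ ℝ`, are enumerated by real-analytic functions
`lam i`, the number `algMult A B μ` is the sum of the orders of vanishing at `μ` of those `lam i`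
that are not identically zero. -/
theorem algMult_eq_sum_order (A B : Matrix (Fin n) (Fin n) ℂ) (lam : Fin n → ℝ → ℝ)
    (han : ∀ i, AnalyticOnNhd ℝ (lam i) Set.univ)
    (hlam : ∀ t : ℝ, (A - (t : ℂ) • B).charpoly =
      ∏ i, (Polynomial.X - Polynomial.C ((lam i t : ℝ) : ℂ)))
    (μ : ℝ) :
    (algMult A B μ : ℕ∞) =
      ∑ i ∈ Finset.univ.filter (fun i => lam i ≠ 0), analyticOrderAt (lam i) μ := by
  set N := Finset.univ.filter (fun i => lam i ≠ 0) with hN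
  set Z := Finset.univ.filter (fun i => ¬ lam i ≠ 0) with hZ
  let g : ℝ → ℝ := fun t => ∏ i ∈ N, (- lam i t)
  have hsplit : ∀ t : ℝ, (A - (t : ℂ) • B).charpoly =
      (∏ i ∈ N, (Polynomial.X - Polynomial.C ((lam i t : ℝ) : ℂ))) * Polynomial.X ^ Z.card := by
    intro t
    rw [hlam t, ← Finset.prod_filter_mul_prod_filter_not Finset.univ (fun i => lam i ≠ 0)]
    congr 1
    rw [← Finset.prod_const]
    refine Finset.prod_congr rfl fun i hi => ?_
    have : lam i = 0 := by simpa [hZ] using hi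
    simp [this]
  have hlow : ∀ j < Z.card, (polyPencil A B).charpoly.coeff j = 0 := by
    intro j hj
    refine Polynomial.eq_zero_of_infinite_isRoot _ ?_
    refine (Set.infinite_range_of_injective Complex.ofReal_injective).mono ?_
    rintro _ ⟨t, rfl⟩
    change Polynomial.eval _ _ = 0
    rw [eval_coeff_charpoly, hsplit, Polynomial.coeff_mul_X_pow', if_neg (by omega)]
  have hval : ∀ t : ℝ, ((polyPencil A B).charpoly.coeff Z.card).eval (t : ℂ) = (g t : ℂ) := by
    intro t
    rw [eval_coeff_charpoly, hsplit, Polynomial.coeff_mul_X_pow', if_pos le_rfl, Nat.sub_self,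
      Polynomial.coeff_zero_eq_eval_zero, Polynomial.eval_prod]
    simp [g]
  have hfin : ∀ i ∈ N, ∀ x, analyticOrderAt (lam i) x ≠ ⊤ := by
    intro i hi x hx
    rw [analyticOrderAt_eq_top] at hx
    have : lam i = 0 := by
      funext y
      exact (han i).eqOn_zero_of_preconnected_of_eventuallyEq_zero isPreconnected_univ
        (Set.mem_univ x) hx (Set.mem_univ y)
    simp [hN] at hi
    exact hi this
  have hord : ∀ S : Finset (Fin n), AnalyticAt ℝ (fun t => ∏ i ∈ S, (- lam i t)) μ ∧
      analyticOrderAt (fun t => ∏ i ∈ S, (- lam i t)) μ = ∑ i ∈ S, analyticOrderAt (lam i) μ := by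
    intro S
    induction S using Finset.induction_on with
    | empty =>
      refine ⟨by simpa using analyticAt_const, ?_⟩
      simp only [Finset.prod_empty, Finset.sum_empty]
      exact (analyticAt_const.analyticOrderAt_eq_zero).2 one_ne_zero
    | insert a S ha ih =>
      have h1 : AnalyticAt ℝ (-lam a) μ := (han a μ (Set.mem_univ _)).neg
      have e : (fun t => ∏ i ∈ insert a S, (- lam i t)) =
          (-lam a) * (fun t => ∏ i ∈ S, (- lam i t)) := by
        funext t
        simp [Finset.prod_insert ha]
      rw [e, Finset.sum_insert ha]
      refine ⟨h1.mul ih.1, ?_⟩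
      rw [analyticOrderAt_mul h1 ih.1, ih.2, analyticOrderAt_neg]
  obtain ⟨hg, hgo⟩ := hord N
  change AnalyticAt ℝ g μ at hg
  change analyticOrderAt g μ = _ at hgo
  have hgt : analyticOrderAt g μ ≠ ⊤ := by
    rw [hgo]
    exact (ENat.sum_ne_top).2 fun i hi => hfin i hi μ
  set c := (polyPencil A B).charpoly.coeff Z.card with hc
  have hc0 : c ≠ 0 := by
    intro h
    apply hgt
    rw [analyticOrderAt_eq_top]
    refine Filter.Eventually.of_forall fun t => ?_
    have := hval t
    rw [h] at this
    simpa using this.symm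
  have htr : eigenfunctionProd A B = c := by
    have hd : (polyPencil A B).charpoly.natTrailingDegree = Z.card := by
      apply le_antisymm
      · exact Polynomial.natTrailingDegree_le_of_ne_zero hc0
      · refine Polynomial.le_natTrailingDegree ?_ hlow
        intro h
        apply hc0
        rw [hc, h, Polynomial.coeff_zero]
    rw [eigenfunctionProd, Polynomial.trailingCoeff, hd]
  rw [← hgo, algMult, htr]
  obtain ⟨k, hk⟩ := ENat.ne_top_iff_exists.1 hgt
  rw [← hk]
  obtain ⟨g1, hg1, hg1n, hgg⟩ := (hg.analyticOrderAt_eq_natCast).1 hk.symm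
  let h : ℝ → ℂ := fun t => c.eval (t : ℂ)
  have hoR : ∀ x : ℝ, AnalyticAt ℝ (fun t : ℝ => (t : ℂ)) x := fun x =>
    Complex.ofRealCLM.analyticAt x
  have hpa : ∀ q : Polynomial ℂ, AnalyticAt ℝ (fun t : ℝ => q.eval (t : ℂ)) μ := by
    intro q
    have h1 : AnalyticAt ℂ (fun z : ℂ => q.eval z) (μ : ℂ) := by
      simpa using AnalyticAt.aeval_polynomial (analyticAt_id (𝕜 := ℂ) (z := (μ : ℂ))) q
    exact (h1.restrictScalars (𝕜 := ℝ)).comp (hoR μ)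
  have e1 : analyticOrderAt h μ = (k : ℕ∞) := by
    refine ((hpa c).analyticOrderAt_eq_natCast).2 ⟨fun t => (g1 t : ℂ), ?_, by simpa using hg1n, ?_⟩
    · exact (Complex.ofRealCLM.analyticAt (g1 μ)).comp hg1
    · filter_upwards [hgg] with t ht
      simp only [hval t, ht]
      simp
  have e2 : analyticOrderAt h μ = ((c.rootMultiplicity (μ : ℂ) : ℕ) : ℕ∞) := by
    obtain ⟨q, hq, hqn⟩ := Polynomial.exists_eq_pow_rootMultiplicity_mul_and_not_dvd c hc0 (μ : ℂ)
    refine ((hpa c).analyticOrderAt_eq_natCast).2 ⟨fun t => q.eval (t : ℂ), hpa q, ?_, ?_⟩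
    · intro h0
      exact hqn (Polynomial.dvd_iff_isRoot.2 h0)
    · refine Filter.Eventually.of_forall fun t => ?_
      conv_lhs => rw [hq]
      simp
  rw [← e1, e2]

end HermitianPencil

end

open scoped Matrix

noncomputable section

namespace HermitianPencil

variable {n : ℕ}

/-! Follow the inertia of `A - t B` along the real line. Exactly `d = defect A B` eigenvalue
functions vanish identically, so `A - t B` always has at least `d` zero eigenvalues. Positive and
negative counts are lower semicontinuous, so near `t` each exceeds its value at `t` by at most the
nullity there minus `d`, hence by at most the algebraic multiplicity of `t`
(`nZero_sub_defect_le_algMult`). No analytic enumeration of the eigenvalues is needed.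

For large `T`, at least `n - k` eigenvalues of `A - T B` are negative and at least `n - k` of those
of `A + T B` are positive, leaving at most `k` of the opposite sign. Comparing the inertia at `0`,
`T` and `-T` (`le_add_sum_of_jumps`) yields the three lower bounds.

The upper bounds follow from the total: the product of the nonzero eigenvalue functions has degree
at most `n - d` (`natDegree_eigenfunctionProd_le`). Subtracting the lower bound for one sign and the
multiplicity of `0` bounds the other sign. -/

/-! ### Nullity and the characteristic polynomial. -/

/-- `n₀(A)`: the number of zero eigenvalues of a Hermitian matrix, with multiplicity. -/
def nZero {A : Matrix (Fin n) (Fin n) ℂ} (hA : A.IsHermitian) : ℕ :=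
  (Finset.univ.filter fun i => hA.eigenvalues i = 0).card

theorem nPos_add_nNeg_add_nZero {A : Matrix (Fin n) (Fin n) ℂ} (hA : A.IsHermitian) :
    nPos hA + nNeg hA + nZero hA = n := by
  have h : ∀ i, (if 0 < hA.eigenvalues i then 1 else 0) + (if hA.eigenvalues i < 0 then 1 else 0)
      + (if hA.eigenvalues i = 0 then 1 else 0) = 1 := by
    intro i
    rcases lt_trichotomy (hA.eigenvalues i) 0 with h | h | h
    · simp [h, h.ne, h.le]
    · simp [h]
    · simp [h, h.ne', h.le]
  simp only [nPos, nNeg, nZero, Finset.card_filter]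
  rw [← Finset.sum_add_distrib, ← Finset.sum_add_distrib]
  simp [h]

theorem rank_add_nZero {A : Matrix (Fin n) (Fin n) ℂ} (hA : A.IsHermitian) :
    A.rank + nZero hA = n := by
  rw [hA.rank_eq_card_non_zero_eigs, Fintype.card_subtype, nZero, add_comm,
    Finset.card_filter_add_card_filter_not]
  simp

theorem isHermitian_pencil {A B : Matrix (Fin n) (Fin n) ℂ} (hA : A.IsHermitian)
    (hB : B.IsHermitian) (t : ℝ) : (A - (t : ℂ) • B).IsHermitian := by
  refine hA.sub ?_
  rw [Matrix.IsHermitian, Matrix.conjTranspose_smul, hB.eq]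
  simp

/-- The characteristic polynomial of a Hermitian matrix vanishes at `0` to order exactly the
number of zero eigenvalues. -/
theorem charpoly_eq_X_pow_mul {A : Matrix (Fin n) (Fin n) ℂ} (hA : A.IsHermitian) :
    ∃ q : Polynomial ℂ, A.charpoly = q * Polynomial.X ^ nZero hA ∧ q.coeff 0 ≠ 0 := by
  refine ⟨∏ i ∈ Finset.univ.filter (fun i => ¬ hA.eigenvalues i = 0),
    (Polynomial.X - Polynomial.C (hA.eigenvalues i : ℂ)), ?_, ?_⟩
  · rw [hA.charpoly_eq, ← Finset.prod_filter_not_mul_prod_filter Finset.univ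
      (fun i => hA.eigenvalues i = 0)]
    congr 1
    rw [nZero, ← Finset.prod_const]
    refine Finset.prod_congr rfl fun i hi => ?_
    simp [(Finset.mem_filter.1 hi).2]
  · rw [Polynomial.coeff_zero_eq_eval_zero, Polynomial.eval_prod, Finset.prod_ne_zero_iff]
    intro i hi
    simpa using (Finset.mem_filter.1 hi).2

theorem charpoly_coeff_of_lt_nZero {A : Matrix (Fin n) (Fin n) ℂ} (hA : A.IsHermitian) {j : ℕ}
    (hj : j < nZero hA) : A.charpoly.coeff j = 0 := by
  obtain ⟨q, hq, -⟩ := charpoly_eq_X_pow_mul hA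
  rw [hq, Polynomial.coeff_mul_X_pow', if_neg (by omega)]

theorem charpoly_coeff_nZero_ne_zero {A : Matrix (Fin n) (Fin n) ℂ} (hA : A.IsHermitian) :
    A.charpoly.coeff (nZero hA) ≠ 0 := by
  obtain ⟨q, hq, h0⟩ := charpoly_eq_X_pow_mul hA
  rwa [hq, Polynomial.coeff_mul_X_pow', if_pos le_rfl, Nat.sub_self]

/-! ### Generic nullity, rank drops and multiplicities. -/

/-- The number of eigenvalue functions of the pencil that vanish identically. -/
def defect (A B : Matrix (Fin n) (Fin n) ℂ) : ℕ := (polyPencil A B).charpoly.natTrailingDegree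

theorem eigenfunctionProd_eq (A B : Matrix (Fin n) (Fin n) ℂ) :
    eigenfunctionProd A B = (polyPencil A B).charpoly.coeff (defect A B) := rfl

theorem eigenfunctionProd_ne_zero (A B : Matrix (Fin n) (Fin n) ℂ) :
    eigenfunctionProd A B ≠ 0 := by
  rw [eigenfunctionProd, Ne, Polynomial.trailingCoeff_eq_zero]
  exact (Matrix.charpoly_monic _).ne_zero

theorem defect_le (A B : Matrix (Fin n) (Fin n) ℂ) : defect A B ≤ n := by
  refine (Polynomial.natTrailingDegree_le_natDegree _).trans ?_
  simp [Matrix.charpoly_natDegree_eq_dim]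

theorem defect_le_nZero {A B : Matrix (Fin n) (Fin n) ℂ} {t : ℝ}
    (h : (A - (t : ℂ) • B).IsHermitian) : defect A B ≤ nZero h := by
  by_contra! hlt
  apply charpoly_coeff_nZero_ne_zero h
  rw [← eval_coeff_charpoly, Polynomial.coeff_eq_zero_of_lt_natTrailingDegree hlt]
  simp

theorem eval_eigenfunctionProd_eq_zero_iff {A B : Matrix (Fin n) (Fin n) ℂ} {t : ℝ}
    (h : (A - (t : ℂ) • B).IsHermitian) :
    (eigenfunctionProd A B).eval (t : ℂ) = 0 ↔ defect A B < nZero h := by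
  rw [eigenfunctionProd_eq, eval_coeff_charpoly]
  constructor
  · intro h0
    refine lt_of_le_of_ne (defect_le_nZero h) fun he => ?_
    rw [he] at h0
    exact charpoly_coeff_nZero_ne_zero h h0
  · exact charpoly_coeff_of_lt_nZero h

/-- This makes the rank condition in `countIn` redundant: every term with nonzero multiplicity
already satisfies it. -/
theorem isEigenvalue_of_algMult_ne_zero {A B : Matrix (Fin n) (Fin n) ℂ} (hA : A.IsHermitian)
    (hB : B.IsHermitian) {t : ℝ} (ht : algMult A B t ≠ 0) :
    IsEigenvalue A B (((t : ℝ) : ℂ) : OnePoint ℂ) := by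
  have h := isHermitian_pencil hA hB t
  have h0 : defect A B < nZero h := by
    rw [← eval_eigenfunctionProd_eq_zero_iff]
    by_contra hne
    exact ht (Polynomial.rootMultiplicity_eq_zero hne)
  -- At a real point off the zeros the nullity is exactly the defect, so the rank there exceeds the
  -- rank at `t`.
  obtain ⟨s, hs⟩ : ∃ s : ℝ, (eigenfunctionProd A B).eval (s : ℂ) ≠ 0 := by
    by_contra! hall
    refine eigenfunctionProd_ne_zero A B (Polynomial.eq_zero_of_infinite_isRoot _ ?_)
    refine (Set.infinite_range_of_injective Complex.ofReal_injective).mono ?_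
    rintro _ ⟨s, rfl⟩
    exact hall s
  have h' := isHermitian_pencil hA hB s
  rw [Ne, eval_eigenfunctionProd_eq_zero_iff h', not_lt] at hs
  have e1 := rank_add_nZero h
  have e2 := rank_add_nZero h'
  have hbdd : BddAbove (Set.range fun z : OnePoint ℂ => (pencilAt A B z).rank) := by
    refine ⟨n, ?_⟩
    rintro _ ⟨z, rfl⟩
    simpa using Matrix.rank_le_width (pencilAt A B z)
  have e3 : (A - (s : ℂ) • B).rank ≤ normalRank A B :=
    le_ciSup hbdd (((s : ℝ) : ℂ) : OnePoint ℂ)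
  change (A - (t : ℂ) • B).rank < normalRank A B
  omega

/-- The coefficient of `x ^ d` in a characteristic polynomial is homogeneous of degree `n - d` in
the matrix entries, and here the entries have degree at most one in `t`. -/
theorem natDegree_eigenfunctionProd_le (A B : Matrix (Fin n) (Fin n) ℂ) :
    (eigenfunctionProd A B).natDegree ≤ n - defect A B := by
  have hd := defect_le A B
  have h := (Matrix.charpoly.univ_coeff_isHomogeneous ℂ (Fin n) (defect A B) (n - defect A B)
    (by simp; omega)).totalDegree_le
  have h2 := MvPolynomial.aeval_natDegree_le (n := 1) _ h
    (fun ij : Fin n × Fin n => polyPencil A B ij.1 ij.2) (by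
      intro ij
      have : polyPencil A B ij.1 ij.2 =
          Polynomial.C (A ij.1 ij.2) - Polynomial.X * Polynomial.C (B ij.1 ij.2) := by
        simp [polyPencil]
      rw [this]
      compute_degree)
  rw [mul_one] at h2
  have h3 := Matrix.charpoly.univ_coeff_eval₂Hom (R := ℂ) (n := Fin n)
    (algebraMap ℂ (Polynomial ℂ)) (fun ij => polyPencil A B ij.1 ij.2) (defect A B)
  rw [eigenfunctionProd_eq]
  exact (congrArg Polynomial.natDegree h3.symm).trans_le h2

/-- If the rows of `D` indexed by `Z` vanish, the coefficients of the characteristic polynomial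
of `D + s E` are divisible by the corresponding powers of `s`. -/
theorem pow_dvd_coeff_charpoly_mul_pow {R : Type*} [CommRing R] (D E : Matrix (Fin n) (Fin n) R)
    (s : R) (Z : Finset (Fin n)) (hD : ∀ i ∈ Z, ∀ j, D i j = 0) (d : ℕ) :
    s ^ Z.card ∣ (D + s • E).charpoly.coeff d * s ^ d := by
  classical
  -- Substituting `s X` for `X` makes each row of the characteristic matrix indexed by `Z` divisible
  -- by `s`, and multiplies the coefficient of `X ^ d` by `s ^ d`.
  let v : Fin n → Polynomial R := fun i => if i ∈ Z then Polynomial.C s else 1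
  let φ : Polynomial R →+* Polynomial R := Polynomial.compRingHom (Polynomial.C s * Polynomial.X)
  let N : Matrix (Fin n) (Fin n) (Polynomial R) := Matrix.of fun i j =>
    if i ∈ Z then (1 : Matrix (Fin n) (Fin n) (Polynomial R)) i j * Polynomial.X -
      Polynomial.C (E i j) else φ ((D + s • E).charmatrix i j)
  have hN : φ.mapMatrix (D + s • E).charmatrix = Matrix.of fun i j => v i * N i j := by
    ext1 i j
    by_cases hi : i ∈ Z
    · simp only [RingHom.mapMatrix_apply, Matrix.map_apply, Matrix.of_apply, v, N, hi, if_true,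
        Matrix.charmatrix_apply, Matrix.add_apply, Matrix.smul_apply, hD i hi j, φ,
        Matrix.diagonal_apply, Matrix.one_apply]
      split_ifs
      · simp
        ring
      · simp
    · simp [v, N, hi]
  have hdet : (D + s • E).charpoly.comp (Polynomial.C s * Polynomial.X) =
      Polynomial.C (s ^ Z.card) * N.det := by
    have : φ (D + s • E).charpoly = (∏ i, v i) * N.det := by
      rw [Matrix.charpoly, RingHom.map_det, hN, Matrix.det_mul_column]
    rw [Polynomial.coe_compRingHom_apply] at this
    rw [this]
    simp [v]
  refine ⟨N.det.coeff d, ?_⟩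
  rw [← Polynomial.comp_C_mul_X_coeff, hdet, Polynomial.coeff_C_mul]

/-- The geometric multiplicity of a real eigenvalue of a Hermitian pencil is at most its algebraic
multiplicity. -/
theorem nZero_sub_defect_le_algMult {A B : Matrix (Fin n) (Fin n) ℂ} {t : ℝ}
    (h : (A - (t : ℂ) • B).IsHermitian) : nZero h - defect A B ≤ algMult A B t := by
  have hd := defect_le_nZero h
  set s : Polynomial ℂ := Polynomial.X - Polynomial.C (t : ℂ) with hs
  rw [algMult, Polynomial.le_rootMultiplicity_iff (eigenfunctionProd_ne_zero A B), ← hs]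
  let U : Matrix (Fin n) (Fin n) ℂ := h.eigenvectorUnitary
  have hU : U * star U = 1 := Unitary.coe_mul_star_self h.eigenvectorUnitary
  -- In an eigenbasis at `t` the recentred pencil is `D + s E`, where the zero eigenvalues give zero
  -- rows of `D`.
  have hdiag : star U * (A - (t : ℂ) • B) * U = Matrix.diagonal (RCLike.ofReal ∘ h.eigenvalues) := by
    rw [← h.conjStarAlgAut_star_eigenvectorUnitary, Unitary.conjStarAlgAut_star_apply]
  let D : Matrix (Fin n) (Fin n) (Polynomial ℂ) :=
    (Matrix.diagonal (RCLike.ofReal ∘ h.eigenvalues)).map Polynomial.C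
  let E : Matrix (Fin n) (Fin n) (Polynomial ℂ) := -(star U * B * U).map Polynomial.C
  have hP : polyPencil A B = (A - (t : ℂ) • B).map Polynomial.C - s • B.map Polynomial.C := by
    ext1 i j
    simp [polyPencil, hs]
    ring
  have hconj : (star U).map Polynomial.C * polyPencil A B * U.map Polynomial.C = D + s • E := by
    simp only [hP, D, E, ← hdiag, Matrix.map_mul]
    rw [Matrix.mul_sub, Matrix.sub_mul, Matrix.mul_smul, Matrix.smul_mul, smul_neg,
      ← sub_eq_add_neg]
  have hchar : (D + s • E).charpoly = (polyPencil A B).charpoly := by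
    rw [← hconj, Matrix.mul_assoc, Matrix.charpoly_mul_comm, Matrix.mul_assoc, ← Matrix.map_mul, hU]
    simp
  have key := pow_dvd_coeff_charpoly_mul_pow D E s
    (Finset.univ.filter fun i => h.eigenvalues i = 0) (by
      intro i hi j
      have := (Finset.mem_filter.1 hi).2
      simp [D, Matrix.diagonal_apply, this]) (defect A B)
  rw [hchar, ← eigenfunctionProd_eq] at key
  change s ^ nZero h ∣ _ at key
  -- Cancelling `s ^ defect` leaves the geometric multiplicity as the exponent.
  rw [← Nat.sub_add_cancel hd, pow_add] at key
  exact (mul_dvd_mul_iff_right (pow_ne_zero _ (Polynomial.X_sub_C_ne_zero _))).1 key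

/-! ### Real eigenvalue counts as finite sums. -/

open scoped Classical in
/-- The finite set of real zeros of the product of the nonzero eigenvalue functions. -/
def realRoots (A B : Matrix (Fin n) (Fin n) ℂ) : Finset ℝ :=
  (eigenfunctionProd A B).roots.toFinset.preimage _ Complex.ofReal_injective.injOn

theorem algMult_eq_zero_of_notMem {A B : Matrix (Fin n) (Fin n) ℂ} {t : ℝ}
    (ht : t ∉ realRoots A B) : algMult A B t = 0 := by
  classical
  by_contra h
  apply ht
  rw [realRoots, Finset.mem_preimage, Multiset.mem_toFinset, ← Multiset.count_pos,
    Polynomial.count_roots]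
  exact Nat.pos_of_ne_zero h

open scoped Classical in
theorem countIn_eq_sum {A B : Matrix (Fin n) (Fin n) ℂ} (hA : A.IsHermitian)
    (hB : B.IsHermitian) (S : Set ℝ) :
    countIn A B S = ∑ t ∈ (realRoots A B).filter (· ∈ S), algMult A B t := by
  rw [countIn, finsum_eq_sum_of_support_subset (s := realRoots A B), Finset.sum_filter]
  · refine Finset.sum_congr rfl fun t _ => ?_
    by_cases h0 : algMult A B t = 0
    · simp [h0]
    · simp [isEigenvalue_of_algMult_ne_zero hA hB h0]
  · intro t ht
    by_contra h
    exact ht (by simp [algMult_eq_zero_of_notMem h])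

theorem sum_algMult_le (A B : Matrix (Fin n) (Fin n) ℂ) :
    ∑ t ∈ realRoots A B, algMult A B t ≤ n - defect A B := by
  classical
  refine le_trans ?_ ((Polynomial.card_roots' _).trans (natDegree_eigenfunctionProd_le A B))
  rw [← Multiset.toFinset_sum_count_eq, realRoots]
  simp only [algMult, ← Polynomial.count_roots]
  rw [Finset.sum_preimage' (f := ((↑) : ℝ → ℂ)) (hf := Complex.ofReal_injective.injOn)
    (g := fun z => Multiset.count z (eigenfunctionProd A B).roots)]
  exact Finset.sum_le_sum_of_subset (Finset.filter_subset _ _)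

/-! ### Variational description of inertia. -/

section Inertia

variable {E ι : Type*} [NormedAddCommGroup E] [InnerProductSpace ℂ E] [Fintype ι]

/-- A form diagonal with coefficients `c` in an orthonormal basis is positive definite only on
subspaces of dimension at most the number of positive coefficients. -/
theorem finrank_le_card_pos (b : OrthonormalBasis ι ℂ E) (c : ι → ℝ) (V : Submodule ℂ E)
    (hV : ∀ x ∈ V, x ≠ 0 → 0 < ∑ i, c i * ‖inner ℂ (b i) x‖ ^ 2) :
    Module.finrank ℂ V ≤ (Finset.univ.filter fun i => 0 < c i).card := by
  -- The coordinates with positive coefficient determine a vector of `V`: if they all vanish, the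
  -- form is nonpositive there.
  let f : V →ₗ[ℂ] ({i // 0 < c i} → ℂ) :=
    LinearMap.pi fun i => (innerₛₗ ℂ (b i)).comp V.subtype
  have hf : Function.Injective f := by
    rw [injective_iff_map_eq_zero]
    intro x hx
    by_contra hne
    refine absurd (hV x x.2 (by simpa using hne)) (not_lt.2 (Finset.sum_nonpos fun i _ => ?_))
    by_cases hi : 0 < c i
    · have : inner ℂ (b i) (x : E) = 0 := congrFun hx ⟨i, hi⟩
      simp [this]
    · exact mul_nonpos_of_nonpos_of_nonneg (not_lt.1 hi) (by positivity)
  have := LinearMap.finrank_le_finrank_of_injective hf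
  rwa [Module.finrank_fintype_fun_eq_card, Fintype.card_subtype] at this

/-- The uniform gap `δ`, the least positive coefficient, is what lets definiteness survive small
perturbations. -/
theorem exists_finrank_eq_card_pos (b : OrthonormalBasis ι ℂ E) (c : ι → ℝ) :
    ∃ V : Submodule ℂ E, Module.finrank ℂ V = (Finset.univ.filter fun i => 0 < c i).card ∧
      ∃ δ > 0, ∀ x ∈ V, δ * ‖x‖ ^ 2 ≤ ∑ i, c i * ‖inner ℂ (b i) x‖ ^ 2 := by
  classical
  let V := Submodule.span ℂ (Set.range fun i : {i // 0 < c i} => b i)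
  refine ⟨V, ?_, ?_⟩
  · rw [finrank_span_eq_card, Fintype.card_subtype]
    exact b.orthonormal.linearIndependent.comp _ Subtype.val_injective
  · have hzero : ∀ i, ¬ 0 < c i → ∀ x ∈ V, inner ℂ (b i) x = 0 := by
      intro i hi x hx
      induction hx using Submodule.span_induction with
      | mem x hx =>
        obtain ⟨j, rfl⟩ := hx
        refine b.orthonormal.2 ?_
        rintro rfl
        exact hi j.2
      | zero => simp
      | add x y _ _ h1 h2 => rw [inner_add_right, h1, h2, add_zero]
      | smul a x _ h1 => rw [inner_smul_right, h1, mul_zero]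
    obtain ⟨δ, hδ, hle⟩ : ∃ δ > 0, ∀ i, 0 < c i → δ ≤ c i := by
      rcases (Finset.univ.filter fun i => 0 < c i).eq_empty_or_nonempty with h | h
      · refine ⟨1, one_pos, fun i hi => ?_⟩
        have : i ∈ Finset.univ.filter fun i => 0 < c i := by simpa using hi
        simp [h] at this
      · obtain ⟨j, hj, hmin⟩ := Finset.exists_min_image _ c h
        exact ⟨c j, (Finset.mem_filter.1 hj).2, fun i hi => hmin i (by simpa using hi)⟩
    refine ⟨δ, hδ, fun x hx => ?_⟩
    rw [← b.sum_sq_norm_inner_right x, Finset.mul_sum]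
    refine Finset.sum_le_sum fun i _ => ?_
    by_cases hi : 0 < c i
    · exact mul_le_mul_of_nonneg_right (hle i hi) (by positivity)
    · simp [hzero i hi x hx]

end Inertia

/-- The Hermitian form `x* A x`, as a real number. -/
def form (A : Matrix (Fin n) (Fin n) ℂ) (x : EuclideanSpace ℂ (Fin n)) : ℝ :=
  (inner ℂ x (Matrix.toEuclideanCLM (𝕜 := ℂ) A x)).re

theorem form_add (A B : Matrix (Fin n) (Fin n) ℂ) (x : EuclideanSpace ℂ (Fin n)) :
    form (A + B) x = form A x + form B x := by
  simp [form]

theorem form_smul (r : ℝ) (A : Matrix (Fin n) (Fin n) ℂ) (x : EuclideanSpace ℂ (Fin n)) :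
    form ((r : ℂ) • A) x = r * form A x := by
  rw [form, map_smul, smul_apply, inner_smul_right, Complex.re_ofReal_mul, form]

theorem form_pencil (A B : Matrix (Fin n) (Fin n) ℂ) (t : ℝ) (x : EuclideanSpace ℂ (Fin n)) :
    form (A - (t : ℂ) • B) x = form A x - t * form B x := by
  have : A - (t : ℂ) • B = A + ((-t : ℝ) : ℂ) • B := by simp [sub_eq_add_neg]
  rw [this, form_add, form_smul]
  ring

theorem abs_form_le (A : Matrix (Fin n) (Fin n) ℂ) (x : EuclideanSpace ℂ (Fin n)) :
    |form A x| ≤ ‖Matrix.toEuclideanCLM (𝕜 := ℂ) A‖ * ‖x‖ ^ 2 := by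
  refine (Complex.abs_re_le_norm _).trans ((norm_inner_le_norm _ _).trans ?_)
  have := (Matrix.toEuclideanCLM (𝕜 := ℂ) A).le_opNorm x
  nlinarith [norm_nonneg x]

theorem form_eq_sum {A : Matrix (Fin n) (Fin n) ℂ} (hA : A.IsHermitian)
    (x : EuclideanSpace ℂ (Fin n)) :
    form A x = ∑ i, hA.eigenvalues i * ‖inner ℂ (hA.eigenvectorBasis i) x‖ ^ 2 := by
  have hsym := Matrix.isSymmetric_toEuclideanLin_iff.mpr hA
  have hev : ∀ i, Matrix.toEuclideanLin A (hA.eigenvectorBasis i) =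
      (hA.eigenvalues i : ℂ) • hA.eigenvectorBasis i := by
    intro i
    apply (WithLp.ofLp_injective 2)
    have := hA.mulVec_eigenvectorBasis i
    ext j
    simpa using congrFun this j
  have h : ∀ i, inner ℂ (hA.eigenvectorBasis i) (Matrix.toEuclideanCLM (𝕜 := ℂ) A x) =
      (hA.eigenvalues i : ℂ) * inner ℂ (hA.eigenvectorBasis i) x := by
    intro i
    have := hsym (hA.eigenvectorBasis i) x
    rw [hev, inner_smul_left, Complex.conj_ofReal] at this
    exact this.symm
  rw [form, ← hA.eigenvectorBasis.sum_inner_mul_inner, Complex.re_sum]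
  refine Finset.sum_congr rfl fun i _ => ?_
  rw [h, mul_left_comm, Complex.re_ofReal_mul, ← inner_conj_symm,
    Complex.conj_mul']
  norm_cast

theorem finrank_le_nPos {A : Matrix (Fin n) (Fin n) ℂ} (hA : A.IsHermitian)
    (V : Submodule ℂ (EuclideanSpace ℂ (Fin n))) (hV : ∀ x ∈ V, x ≠ 0 → 0 < form A x) :
    Module.finrank ℂ V ≤ nPos hA :=
  finrank_le_card_pos hA.eigenvectorBasis hA.eigenvalues V fun x hx h0 => by
    rw [← form_eq_sum]; exact hV x hx h0

theorem finrank_le_nNeg {A : Matrix (Fin n) (Fin n) ℂ} (hA : A.IsHermitian)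
    (V : Submodule ℂ (EuclideanSpace ℂ (Fin n))) (hV : ∀ x ∈ V, x ≠ 0 → form A x < 0) :
    Module.finrank ℂ V ≤ nNeg hA := by
  have := finrank_le_card_pos hA.eigenvectorBasis (-hA.eigenvalues) V fun x hx h0 => by
    have := hV x hx h0
    rw [form_eq_sum hA] at this
    simpa using this
  simpa [nNeg] using this

theorem exists_finrank_eq_nPos {A : Matrix (Fin n) (Fin n) ℂ} (hA : A.IsHermitian) :
    ∃ V : Submodule ℂ (EuclideanSpace ℂ (Fin n)), Module.finrank ℂ V = nPos hA ∧
      ∃ δ > 0, ∀ x ∈ V, δ * ‖x‖ ^ 2 ≤ form A x := by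
  simpa only [form_eq_sum hA, nPos] using exists_finrank_eq_card_pos hA.eigenvectorBasis hA.eigenvalues

theorem exists_finrank_eq_nNeg {A : Matrix (Fin n) (Fin n) ℂ} (hA : A.IsHermitian) :
    ∃ V : Submodule ℂ (EuclideanSpace ℂ (Fin n)), Module.finrank ℂ V = nNeg hA ∧
      ∃ δ > 0, ∀ x ∈ V, form A x ≤ -(δ * ‖x‖ ^ 2) := by
  obtain ⟨V, h1, δ, hδ, h2⟩ := exists_finrank_eq_card_pos hA.eigenvectorBasis (-hA.eigenvalues)
  refine ⟨V, by simpa [nNeg] using h1, δ, hδ, fun x hx => ?_⟩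
  have := h2 x hx
  rw [form_eq_sum hA]
  simp only [Pi.neg_apply, neg_mul, Finset.sum_neg_distrib] at this
  linarith

/-! ### Local and asymptotic behaviour of the inertia of the pencil. -/

section Pencil

variable {A B : Matrix (Fin n) (Fin n) ℂ} (hA : A.IsHermitian) (hB : B.IsHermitian)

open Filter Topology

theorem eventually_abs_mul_form_lt (B : Matrix (Fin n) (Fin n) ℂ) (t₀ : ℝ) {δ : ℝ} (hδ : 0 < δ) :
    ∀ᶠ t in 𝓝 t₀, ∀ x : EuclideanSpace ℂ (Fin n), x ≠ 0 →
      |(t - t₀) * form B x| < δ * ‖x‖ ^ 2 := by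
  have hlim : Tendsto (fun t : ℝ => |t - t₀| * ‖Matrix.toEuclideanCLM (𝕜 := ℂ) B‖) (𝓝 t₀)
      (𝓝 0) := by
    have : Continuous fun t : ℝ => |t - t₀| * ‖Matrix.toEuclideanCLM (𝕜 := ℂ) B‖ := by fun_prop
    simpa using this.tendsto t₀
  filter_upwards [hlim.eventually (gt_mem_nhds hδ)] with t ht x hx
  have hx' : 0 < ‖x‖ ^ 2 := by positivity
  calc |(t - t₀) * form B x| = |t - t₀| * |form B x| := abs_mul _ _
    _ ≤ |t - t₀| * (‖Matrix.toEuclideanCLM (𝕜 := ℂ) B‖ * ‖x‖ ^ 2) :=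
        mul_le_mul_of_nonneg_left (abs_form_le B x) (abs_nonneg _)
    _ = |t - t₀| * ‖Matrix.toEuclideanCLM (𝕜 := ℂ) B‖ * ‖x‖ ^ 2 := by ring
    _ < δ * ‖x‖ ^ 2 := mul_lt_mul_of_pos_right ht hx'

/-- A maximal positive subspace at `t₀` stays positive nearby, since the perturbation is smaller
than its gap. -/
theorem eventually_nPos_ge (t₀ : ℝ) : ∀ᶠ t in 𝓝 t₀,
    nPos (isHermitian_pencil hA hB t₀) ≤ nPos (isHermitian_pencil hA hB t) := by
  obtain ⟨V, hV, δ, hδ, hform⟩ := exists_finrank_eq_nPos (isHermitian_pencil hA hB t₀)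
  filter_upwards [eventually_abs_mul_form_lt B t₀ hδ] with t ht
  rw [← hV]
  refine finrank_le_nPos _ V fun x hx h0 => ?_
  have h1 := hform x hx
  have h2 := (abs_lt.1 (ht x h0)).2
  rw [form_pencil] at h1 ⊢
  linarith

theorem eventually_nNeg_ge (t₀ : ℝ) : ∀ᶠ t in 𝓝 t₀,
    nNeg (isHermitian_pencil hA hB t₀) ≤ nNeg (isHermitian_pencil hA hB t) := by
  obtain ⟨V, hV, δ, hδ, hform⟩ := exists_finrank_eq_nNeg (isHermitian_pencil hA hB t₀)
  filter_upwards [eventually_abs_mul_form_lt B t₀ hδ] with t ht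
  rw [← hV]
  refine finrank_le_nNeg _ V fun x hx h0 => ?_
  have h1 := hform x hx
  have h2 := (abs_lt.1 (ht x h0)).1
  rw [form_pencil] at h1 ⊢
  linarith

/-- Nearby, the negative count has not dropped and the nullity is still at least the defect, so only
the excess nullity at `t₀` can turn positive. -/
theorem eventually_nPos_le_add_algMult (t₀ : ℝ) : ∀ᶠ t in 𝓝 t₀,
    nPos (isHermitian_pencil hA hB t) ≤ nPos (isHermitian_pencil hA hB t₀) + algMult A B t₀ := by
  filter_upwards [eventually_nNeg_ge hA hB t₀] with t ht
  have h1 := nPos_add_nNeg_add_nZero (isHermitian_pencil hA hB t)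
  have h2 := nPos_add_nNeg_add_nZero (isHermitian_pencil hA hB t₀)
  have h3 := nZero_sub_defect_le_algMult (isHermitian_pencil hA hB t₀)
  have h4 := defect_le_nZero (isHermitian_pencil hA hB t)
  omega

theorem eventually_nNeg_le_add_algMult (t₀ : ℝ) : ∀ᶠ t in 𝓝 t₀,
    nNeg (isHermitian_pencil hA hB t) ≤ nNeg (isHermitian_pencil hA hB t₀) + algMult A B t₀ := by
  filter_upwards [eventually_nPos_ge hA hB t₀] with t ht
  have h1 := nPos_add_nNeg_add_nZero (isHermitian_pencil hA hB t)
  have h2 := nPos_add_nNeg_add_nZero (isHermitian_pencil hA hB t₀)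
  have h3 := nZero_sub_defect_le_algMult (isHermitian_pencil hA hB t₀)
  have h4 := defect_le_nZero (isHermitian_pencil hA hB t)
  omega

/-- Far out on the real axis the inertia of `A - t B` is controlled by the positive part of `B`. -/
theorem exists_nPos_le_inertia_pencil : ∃ T > 0,
    nPos hB ≤ nNeg (isHermitian_pencil hA hB T) ∧
      nPos hB ≤ nPos (isHermitian_pencil hA hB (-T)) := by
  obtain ⟨V, hV, δ, hδ, hform⟩ := exists_finrank_eq_nPos hB
  set K := ‖Matrix.toEuclideanCLM (𝕜 := ℂ) A‖
  have hK : 0 ≤ K := norm_nonneg _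
  -- With `T = (K + 1) / δ`, the form of `T B` on `V` is at least `(K + 1) ‖x‖ ^ 2`, beating the
  -- bound `K ‖x‖ ^ 2` for `A`.
  have hT : (K + 1) / δ * δ = K + 1 := div_mul_cancel₀ _ hδ.ne'
  have hTpos : 0 < (K + 1) / δ := by positivity
  have key : ∀ x ∈ V, x ≠ 0 → |form A x| < (K + 1) / δ * form B x := by
    intro x hx h0
    have hx' : 0 < ‖x‖ ^ 2 := by positivity
    have h1 := mul_le_mul_of_nonneg_left (hform x hx) hTpos.le
    rw [← mul_assoc, hT] at h1
    have h2 : |form A x| ≤ K * ‖x‖ ^ 2 := abs_form_le A x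
    linarith
  refine ⟨(K + 1) / δ, hTpos, ?_, ?_⟩
  · rw [← hV]
    refine finrank_le_nNeg _ V fun x hx h0 => ?_
    rw [form_pencil]
    linarith [(abs_lt.1 (key x hx h0)).2]
  · rw [← hV]
    refine finrank_le_nPos _ V fun x hx h0 => ?_
    rw [form_pencil]
    linarith [(abs_lt.1 (key x hx h0)).1]

end Pencil

/-! ### From local jump bounds to global ones. -/

section Jumps

open Filter Topology

/-- A real function that is monotone in a neighbourhood of each point, relative to that point, is
monotone. -/
theorem monotone_of_eventually_monotone_at {G : ℝ → ℕ}
    (h : ∀ t₀, ∀ᶠ t in 𝓝 t₀, (t ≤ t₀ → G t ≤ G t₀) ∧ (t₀ ≤ t → G t₀ ≤ G t)) : Monotone G := by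
  intro a b hab
  by_contra! hlt
  let T : Set ℝ := {u | a ≤ u ∧ G u < G a}
  have hbT : b ∈ T := ⟨hab, hlt⟩
  have hbdd : BddBelow T := ⟨a, fun u hu => hu.1⟩
  have ha : a ≤ sInf T := le_csInf ⟨b, hbT⟩ fun u hu => hu.1
  obtain ⟨ε, hε, hloc⟩ := Metric.eventually_nhds_iff.1 (h (sInf T))
  -- Points just left of the infimum are not in `T`, so the infimum itself is no violation; points
  -- just to its right then cannot be either.
  have hGa : G a ≤ G (sInf T) := by
    rcases ha.eq_or_lt with heq | hlt'
    · rw [← heq]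
    · have h1 : max a (sInf T - ε / 2) < sInf T := max_lt hlt' (by linarith)
      have h2 := (hloc (y := max a (sInf T - ε / 2)) (by
        rw [Real.dist_eq, abs_sub_comm, abs_of_pos (by linarith)]
        linarith [le_max_right a (sInf T - ε / 2)])).1 h1.le
      have h3 : max a (sInf T - ε / 2) ∉ T := fun hm => absurd (csInf_le hbdd hm) (not_le.2 h1)
      have h4 : ¬ G (max a (sInf T - ε / 2)) < G a := fun hm => h3 ⟨le_max_left _ _, hm⟩
      omega
  obtain ⟨u, hu, hlt'⟩ := exists_lt_of_csInf_lt ⟨b, hbT⟩ (show sInf T < sInf T + ε by linarith)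
  have hle := csInf_le hbdd hu
  have := (hloc (y := u) (by
    rw [Real.dist_eq, abs_of_nonneg (by linarith)]; linarith)).2 hle
  have := hu.2
  omega

variable {f m : ℝ → ℕ} {R : Finset ℝ}

/-- An integer-valued function whose jump at each point `t` is bounded by `m t` falls by at most
the sum of `m` over the points passed. -/
theorem le_add_sum_of_jumps (hm : ∀ t ∉ R, m t = 0)
    (h1 : ∀ t₀, ∀ᶠ t in 𝓝 t₀, f t₀ ≤ f t) (h2 : ∀ t₀, ∀ᶠ t in 𝓝 t₀, f t ≤ f t₀ + m t₀)
    {a b : ℝ} (hab : a ≤ b) : f a ≤ f b + ∑ t ∈ R.filter (fun t => a < t ∧ t ≤ b), m t := by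
  -- Adding the accumulated multiplicity, which jumps by `m t₀` on reaching `t₀`, compensates every
  -- possible fall of `f`. Leaving `t₀` to the right costs nothing, hence the half-open interval.
  let C : ℝ → ℕ := fun u => ∑ t ∈ R.filter (· ≤ u), m t
  have hC : ∀ {u v : ℝ}, u ≤ v → C v = C u + ∑ t ∈ R.filter (fun t => u < t ∧ t ≤ v), m t := by
    intro u v huv
    simp only [C]
    rw [← Finset.sum_union]
    · congr 1
      ext t
      simp only [Finset.mem_union, Finset.mem_filter]
      grind
    · rw [Finset.disjoint_left]
      intro t
      simp only [Finset.mem_filter]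
      grind
  have hmono : Monotone fun u => f u + C u := by
    refine monotone_of_eventually_monotone_at fun t₀ => ?_
    filter_upwards [h1 t₀, h2 t₀] with t ht1 ht2
    refine ⟨fun hle => ?_, fun hle => ?_⟩
    · rcases hle.eq_or_lt with rfl | hlt
      · exact le_rfl
      have h3 := hC hle
      have h4 : m t₀ ≤ ∑ u ∈ R.filter (fun u => t < u ∧ u ≤ t₀), m u := by
        by_cases h0 : t₀ ∈ R
        · exact Finset.single_le_sum (f := m) (fun _ _ => Nat.zero_le _)
            (by simp [h0, hlt])
        · simp [hm t₀ h0]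
      omega
    · have h3 := hC hle
      omega
  have h3 : f a + C a ≤ f b + C b := hmono hab
  have h4 := hC hab
  omega

/-- The analogue of `le_add_sum_of_jumps` for the growth of the function. -/
theorem le_add_sum_of_jumps' (hm : ∀ t ∉ R, m t = 0)
    (h1 : ∀ t₀, ∀ᶠ t in 𝓝 t₀, f t₀ ≤ f t) (h2 : ∀ t₀, ∀ᶠ t in 𝓝 t₀, f t ≤ f t₀ + m t₀)
    {a b : ℝ} (hab : a ≤ b) : f b ≤ f a + ∑ t ∈ R.filter (fun t => a ≤ t ∧ t < b), m t := by
  have hneg : ∀ t₀ : ℝ, Tendsto (fun t => -t) (𝓝 t₀) (𝓝 (-t₀)) := fun t₀ =>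
    continuous_neg.tendsto t₀
  -- Reflection `t ↦ -t`, which also swaps the closed end of the interval.
  have := le_add_sum_of_jumps (f := fun t => f (-t)) (m := fun t => m (-t))
    (R := R.map (Equiv.neg ℝ).toEmbedding)
    (fun t ht => hm _ (by simpa using ht))
    (fun t₀ => (hneg t₀).eventually (h1 (-t₀)))
    (fun t₀ => (hneg t₀).eventually (h2 (-t₀))) (neg_le_neg hab)
  simp only [neg_neg, Finset.filter_map, Finset.sum_map] at this
  refine this.trans_eq ?_
  congr 1
  refine Finset.sum_congr ?_ (by simp)
  ext t
  simp only [Finset.mem_filter, Function.comp_apply, Equiv.coe_toEmbedding, Equiv.neg_apply]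
  grind

end Jumps

end HermitianPencil

end

/-! ### Assembly of the bounds. -/

open HermitianPencil in
theorem corollary4p2 (n k : ℕ) (A B : Matrix (Fin n) (Fin n) ℂ)
    (hA : A.IsHermitian) (hB : B.IsHermitian)
    (hk : (HermitianPencil.nPos hB : ℤ) = (n : ℤ) - (k : ℤ))
    (hsmall : |(HermitianPencil.nNeg hA : ℤ) - (HermitianPencil.nPos hA : ℤ)| ≤
      (n : ℤ) - (k : ℤ)) :
    ((HermitianPencil.nPos hA : ℤ) - k ≤ HermitianPencil.pencilPos A B ∧
      (HermitianPencil.pencilPos A B : ℤ) ≤ HermitianPencil.nPos hA + k) ∧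
    ((HermitianPencil.nNeg hA : ℤ) - k ≤ HermitianPencil.pencilNeg A B ∧
      (HermitianPencil.pencilNeg A B : ℤ) ≤ HermitianPencil.nNeg hA + k) ∧
    ((n : ℤ) - 2 * k ≤ HermitianPencil.pencilReal A B ∧
      (HermitianPencil.pencilReal A B : ℤ) ≤ n) := by
  classical
  obtain ⟨T, hT, hTneg, hTpos⟩ := exists_nPos_le_inertia_pencil hA hB
  have eP : pencilPos A B = ∑ t ∈ (realRoots A B).filter (0 < ·), algMult A B t :=
    countIn_eq_sum hA hB _
  have eN : pencilNeg A B = ∑ t ∈ (realRoots A B).filter (· < 0), algMult A B t :=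
    countIn_eq_sum hA hB _
  have eR : pencilReal A B = ∑ t ∈ realRoots A B, algMult A B t := by
    rw [pencilReal, countIn_eq_sum hA hB]
    simp
  have hm : ∀ t ∉ realRoots A B, algMult A B t = 0 := fun t => algMult_eq_zero_of_notMem
  have hsplit : pencilReal A B = pencilPos A B + pencilNeg A B + algMult A B 0 := by
    rw [eP, eN, eR, ← Finset.sum_filter_add_sum_filter_not (realRoots A B) (0 < ·), add_assoc]
    congr 1
    rw [← Finset.sum_filter_add_sum_filter_not _ (· < (0 : ℝ)), Finset.filter_filter,
      Finset.filter_filter]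
    congr 1
    · refine Finset.sum_congr ?_ fun _ _ => rfl
      ext t
      simp only [Finset.mem_filter]
      grind
    · by_cases h0 : (0 : ℝ) ∈ realRoots A B
      · refine Finset.sum_eq_single_of_mem (0 : ℝ) (by simp [h0]) fun t ht hne => ?_
        simp only [Finset.mem_filter] at ht
        exact absurd (le_antisymm (not_lt.1 ht.2.1) (not_lt.1 ht.2.2)) hne
      · rw [hm 0 h0]
        refine Finset.sum_eq_zero fun t ht => ?_
        simp only [Finset.mem_filter] at ht
        rw [le_antisymm (not_lt.1 ht.2.1) (not_lt.1 ht.2.2), hm 0 h0]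
  have hsum := sum_algMult_le A B
  have hd := defect_le A B
  have hA0 : A - ((0 : ℝ) : ℂ) • B = A := by simp
  have h0P : nPos (isHermitian_pencil hA hB 0) = nPos hA := by congr!
  have h0N : nNeg (isHermitian_pencil hA hB 0) = nNeg hA := by congr!
  have h0Z := nZero_sub_defect_le_algMult (isHermitian_pencil hA hB 0)
  have h0S := nPos_add_nNeg_add_nZero (isHermitian_pencil hA hB 0)
  have hTS := nPos_add_nNeg_add_nZero (isHermitian_pencil hA hB T)
  have hTS' := nPos_add_nNeg_add_nZero (isHermitian_pencil hA hB (-T))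
  -- The half-open intervals in `h1` and `h2` omit `0`, so its multiplicity is charged to neither
  -- sign.
  have h1 := le_add_sum_of_jumps (f := fun t => nPos (isHermitian_pencil hA hB t)) hm
    (eventually_nPos_ge hA hB) (eventually_nPos_le_add_algMult hA hB) hT.le
  have h2 := le_add_sum_of_jumps' (f := fun t => nNeg (isHermitian_pencil hA hB t)) hm
    (eventually_nNeg_ge hA hB) (eventually_nNeg_le_add_algMult hA hB) (neg_nonpos.2 hT.le)
  have h3 := le_add_sum_of_jumps (f := fun t => nPos (isHermitian_pencil hA hB t)) hm
    (eventually_nPos_ge hA hB) (eventually_nPos_le_add_algMult hA hB)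
    (show -T ≤ T by linarith)
  have l1 : ∑ t ∈ (realRoots A B).filter (fun t => 0 < t ∧ t ≤ T), algMult A B t ≤
      pencilPos A B := by
    rw [eP]
    exact Finset.sum_le_sum_of_subset (Finset.monotone_filter_right _ fun t _ ht => ht.1)
  have l2 : ∑ t ∈ (realRoots A B).filter (fun t => -T ≤ t ∧ t < 0), algMult A B t ≤
      pencilNeg A B := by
    rw [eN]
    exact Finset.sum_le_sum_of_subset (Finset.monotone_filter_right _ fun t _ ht => ht.2)
  have l3 : ∑ t ∈ (realRoots A B).filter (fun t => -T < t ∧ t ≤ T), algMult A B t ≤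
      pencilReal A B := by
    rw [eR]
    exact Finset.sum_le_sum_of_subset (Finset.filter_subset _ _)
  -- For the upper bounds, the positive count is at most `(n - d) - (n₋(A) - k) - (n₀(A) - d) =
  -- n₊(A) + k`, and symmetrically for the negative one.
  omega
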